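/- Let $K\subset\mathbb R^n$ be a convex body (compact, convex, with non-empty interior) with $K=-K$. For a boundary point $x$ with a unique outer unit normal $N$ and for $h>0$, let $$A_h=\{y\in N^\perp:\ x-hN+\sqrt{2h}\,y\in K\}$$ be the section of $K$ by the hyperplane orthogonal to $N$ at depth $h$ below $x$, projected to $N^\perp$ with the projection of $x$ as origin and rescaled by $1/\sqrt{2h}$. The point $x$ is called *normal* if the Dupin indicatrix of $K$ at $x$ exists, i.e. if as $h\to0^+$ the sets $A_h$ converge, in the Hausdorff sense on bounded sets, to a set of the form $$D=\Big\{y\in N^\perp:\ \sum_{i=1}^{n-1}k_i\langle b_i,y\rangle^2\le 1\Big\}$$ with $b_1,\dots,b_{n-1}$ an orthonormal basis of $N^\perp$ and $k_1,\dots,k_{n-1}\ge0$ (an ellipsoid, or a cylinder over an ellipsoid, with semi-axes $k_i^{-1/2}$). The Gauss–Kronecker curvature of $\partial K$ at $x$ is then $\kappa(x)=\prod_{i=1}^{n-1}k_i$, the product of the reciprocal squares of the semi-axes of the indicatrix. Theorem 3.1. Let $x$ be a normal point of $\partial K$, with outer unit normal $N$. Then $\kappa(x)\ge0$ is well defined,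 and for every $\tau>0$ the following holds. For all sufficiently small $h>0$ there is exactly one point $x_h=\lambda x$ with $\lambda>0$ such that $K\cap(x_h+\tau K)$ has width $h$ in the direction $N$, and $$\kappa(x)=\lim_{h\to0^+}\frac{c_n^{\,n+1}h^{n+1}}{\left(\frac{1+\tau}{\tau}\right)^{n-1}|K\cap(x_h+\tau K)|^2},\qquad c_n=2\left(\frac{\omega_{n-1}}{n+1}\right)^{\frac{2}{n+1}},$$ where $|\cdot|$ is $n$-dimensional Lebesgue measure and $\omega_k$ is the volume of the $k$-dimensional Euclidean unit ball ($\omega_0=1$). Both $\kappa(x)>0$ and $\kappa(x)=0$ are allowed. -/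

import Mathlib

open Set Filter Topology MeasureTheory Metric
open scoped Pointwise

noncomputable section

/-- `N` is an outer unit normal vector of the set `K` at the point `x`. -/
def IsOuterUnitNormal {n : ℕ} (K : Set (EuclideanSpace ℝ (Fin n)))
    (x N : EuclideanSpace ℝ (Fin n)) : Prop :=
  ‖N‖ = 1 ∧ ∀ y ∈ K, inner ℝ y N ≤ inner ℝ x N

/-- The section of `K` by the hyperplane orthogonal to `N` at depth `h` below `x`, projected
orthogonally to the hyperplane `N^⊥`, with the projection of `x` as the origin, and rescaled by the
factor `1 / √(2h)`. -/
def rescaledSection {n : ℕ} (K : Set (EuclideanSpace ℝ (Fin n)))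
    (x N : EuclideanSpace ℝ (Fin n)) (h : ℝ) : Set ((Submodule.span ℝ {N})ᗮ) :=
  {y | x - h • N + √(2 * h) • (y : EuclideanSpace ℝ (Fin n)) ∈ K}

/-- Convergence `A h → D` as `h → 0+` in the Hausdorff sense on bounded sets (the limit `D` may be
unbounded). -/
def TendstoLocallyHausdorff {F : Type*} [NormedAddCommGroup F] (A : ℝ → Set F) (D : Set F) : Prop :=
  ∀ R > 0, ∀ ε > 0, ∀ᶠ h in 𝓝[>] (0 : ℝ),
    A h ∩ closedBall 0 R ⊆ thickening ε D ∧ D ∩ closedBall 0 R ⊆ thickening ε (A h)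

/-- The solid ellipsoid, or cylinder over an ellipsoid, with axes in the directions `b i` and
semi-axes `1 / √(k i)` (infinite when `k i = 0`). -/
def solidQuadric {F ι : Type*} [NormedAddCommGroup F] [InnerProductSpace ℝ F] [Fintype ι]
    (b : OrthonormalBasis ι ℝ F) (k : ι → ℝ) : Set F :=
  {y | ∑ i, k i * (inner ℝ (b i) y) ^ 2 ≤ 1}

/-- `x` is a boundary point of `K` at which `N` is the unique outer unit normal vector, and `D` is
the Dupin indicatrix of `K` at `x`: the limit of the rescaled sections parallel to the tangent
hyperplane, this limit being an ellipsoid or a cylinder over an ellipsoid. -/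
def IsDupinIndicatrix {n : ℕ} (K : Set (EuclideanSpace ℝ (Fin n)))
    (x N : EuclideanSpace ℝ (Fin n)) (D : Set ((Submodule.span ℝ {N})ᗮ)) : Prop :=
  x ∈ frontier K ∧ IsOuterUnitNormal K x N ∧ (∀ M, IsOuterUnitNormal K x M → M = N) ∧
  TendstoLocallyHausdorff (rescaledSection K x N) D ∧
  ∃ (b : OrthonormalBasis (Fin (n - 1)) ℝ ((Submodule.span ℝ {N})ᗮ)) (k : Fin (n - 1) → ℝ),
    (∀ i, 0 ≤ k i) ∧ D = solidQuadric b k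

/-- A normal boundary point of `K` is one at which the Dupin indicatrix exists. -/
def IsNormalPoint {n : ℕ} (K : Set (EuclideanSpace ℝ (Fin n)))
    (x : EuclideanSpace ℝ (Fin n)) : Prop :=
  ∃ (N : EuclideanSpace ℝ (Fin n)) (D : Set ((Submodule.span ℝ {N})ᗮ)), IsDupinIndicatrix K x N D

/-- `κ` is the Gauss–Kronecker curvature of `∂K` at `x`: the product of the principal curvatures,
which are the reciprocal squares of the semi-axes of the Dupin indicatrix. -/
def IsGaussKroneckerCurvature {n : ℕ} (K : Set (EuclideanSpace ℝ (Fin n)))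
    (x : EuclideanSpace ℝ (Fin n)) (κ : ℝ) : Prop :=
  ∃ (N : EuclideanSpace ℝ (Fin n))
    (b : OrthonormalBasis (Fin (n - 1)) ℝ ((Submodule.span ℝ {N})ᗮ)) (k : Fin (n - 1) → ℝ),
    (∀ i, 0 ≤ k i) ∧ IsDupinIndicatrix K x N (solidQuadric b k) ∧ κ = ∏ i, k i

/-- The width of a bounded set `A` in the direction of the unit vector `N`. -/
def widthInDirection {n : ℕ} (A : Set (EuclideanSpace ℝ (Fin n)))
    (N : EuclideanSpace ℝ (Fin n)) : ℝ :=
  sSup ((fun y => inner ℝ y N) '' A) - sInf ((fun y => inner ℝ y N) '' A)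

/-- `p` is a point `l • x` with `l > 0` such that `K ∩ (p + τ K)` has width `h` in direction `N`. -/
def IsPointOfWidth {n : ℕ} (K : Set (EuclideanSpace ℝ (Fin n))) (τ : ℝ)
    (x N : EuclideanSpace ℝ (Fin n)) (h : ℝ) (p : EuclideanSpace ℝ (Fin n)) : Prop :=
  (∃ l : ℝ, 0 < l ∧ p = l • x) ∧ widthInDirection (K ∩ (p +ᵥ τ • K)) N = h

/-- The volume `ω_k` of the `k`-dimensional Euclidean unit ball. -/
def unitBallVolume (k : ℕ) : ℝ :=
  volume.real (closedBall (0 : EuclideanSpace ℝ (Fin k)) 1)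

/-- The constant `c_n = 2 (ω_{n-1} / (n+1)) ^ (2 / (n+1))`. -/
def curvatureConst (n : ℕ) : ℝ :=
  2 * (unitBallVolume (n - 1) / (n + 1)) ^ ((2 : ℝ) / (n + 1))

end

/-! Write H = ⟨x, N⟩. Central symmetry makes both K and p + τK, with p = l • x, attain their extreme
heights along N on the line ℝx. For small h this forces l = 1 + τ - h/H, and the intersection is a
thin lens in the slab of depth 0 to h below x.

Use the parabolic coordinates x - hrN + √(2h)w with w ⊥ N. The fibre of K at level r is √r times the
rescaled section at depth hr, so it tends to {Q ≤ r}, where Q is the quadratic form of the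
indicatrix. Reflecting the other body onto K turns its fibre into a section at depth h(1 - r)/τ, up
to a shift of order √h, with limit {Q ≤ τ(1 - r)}. The rescaled lens thus tends to a double
paraboloid, whose volume is 2/(n+1) · (τ/(1+τ))^((n-1)/2) · |D|.

The volume of the lens is h(2h)^((n-1)/2) times the rescaled volume, and |D| = ω_{n-1}/√κ, infinite
if κ = 0; squaring gives the formula. Convexity upgrades Hausdorff convergence to pointwise
convergence of indicators (`ae_eventually_mem_iff_mem_doubleParaboloid`), and
`tendsto_volume_doubleParaboloid` passes to volumes. Since the quotient in the formula does not
involve the axes, its limit also shows that κ is unique. -/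

/-! ### Pointwise consequences of local Hausdorff convergence. -/

section LocallyHausdorff

/-- The product filter lets the tested point move with `h`, as the shifted fibres of the dilate
require. -/
lemma TendstoLocallyHausdorff.eventually_notMem {F : Type*} [NormedAddCommGroup F]
    {A : ℝ → Set F} {D : Set F} (hA : TendstoLocallyHausdorff A D) (hD : IsClosed D) {y : F} (hy : y ∉ D) :
    ∀ᶠ p in 𝓝[>] (0 : ℝ) ×ˢ 𝓝 y, p.2 ∉ A p.1 := by
  obtain ⟨ε, hε, hball⟩ := Metric.isOpen_iff.1 hD.isOpen_compl y hy
  have h1 := hA (‖y‖ + ε) (by positivity) (ε / 2) (by positivity)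
  have h2 : ∀ᶠ z in 𝓝 y, z ∈ ball y (ε / 2) := ball_mem_nhds y (by positivity)
  filter_upwards [h1.prod_mk h2] with p hp hmem
  obtain ⟨⟨hsub, -⟩, hz⟩ := hp
  rw [mem_ball] at hz
  have hnorm : p.2 ∈ closedBall (0 : F) (‖y‖ + ε) := by
    rw [mem_closedBall_zero_iff]
    have := norm_le_norm_add_norm_sub y p.2
    rw [dist_comm, dist_eq_norm] at hz
    linarith
  obtain ⟨z, hzD, hzd⟩ := mem_thickening_iff.1 (hsub ⟨hmem, hnorm⟩)
  refine absurd hzD (hball (mem_ball.2 ?_))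
  calc dist z y ≤ dist z p.2 + dist p.2 y := dist_triangle _ _ _
    _ < ε := by rw [dist_comm z]; linarith

variable {F : Type*} [NormedAddCommGroup F] [InnerProductSpace ℝ F]

/-- Hausdorff closeness only gives nearby points of `A h`; convexity fills the gap. If a hyperplane
separated the point from `A h`, moving by ε/2 along its normal would stay in `D`, yet every point
there is within ε/4 of `A h`. -/
lemma TendstoLocallyHausdorff.eventually_mem [CompleteSpace F] {A : ℝ → Set F} {D : Set F}
    (hA : TendstoLocallyHausdorff A D) (hconv : ∀ h, Convex ℝ (A h)) (hclosed : ∀ h, IsClosed (A h))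
    {y : F} (hy : y ∈ interior D) :
    ∀ᶠ p in 𝓝[>] (0 : ℝ) ×ˢ 𝓝 y, p.2 ∈ A p.1 := by
  obtain ⟨ε, hε, hball⟩ := Metric.isOpen_iff.1 isOpen_interior y hy
  have h1 := hA (‖y‖ + ε) (by positivity) (ε / 4) (by positivity)
  have h2 : ∀ᶠ z in 𝓝 y, z ∈ ball y (ε / 4) := ball_mem_nhds y (by positivity)
  filter_upwards [h1.prod_mk h2] with p hp
  obtain ⟨⟨-, hsub⟩, hz⟩ := hp
  rw [mem_ball] at hz
  have key : ∀ v : F, ‖v‖ ≤ ε / 2 → ∃ a ∈ A p.1, ‖p.2 + v - a‖ < ε / 4 := by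
    intro v hv
    have hd : dist (p.2 + v) y < ε := by
      calc dist (p.2 + v) y ≤ dist (p.2 + v) p.2 + dist p.2 y := dist_triangle _ _ _
        _ < ε := by rw [dist_self_add_left]; linarith
    have hn : p.2 + v ∈ closedBall (0 : F) (‖y‖ + ε) := by
      rw [mem_closedBall_zero_iff]
      have := norm_le_norm_add_norm_sub y (p.2 + v)
      rw [dist_comm, dist_eq_norm] at hd
      linarith
    obtain ⟨a, ha, had⟩ := mem_thickening_iff.1 (hsub ⟨interior_subset (hball hd), hn⟩)
    exact ⟨a, ha, by rwa [dist_eq_norm] at had⟩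
  by_contra hmem
  obtain ⟨f, u, hfa, hfu⟩ := geometric_hahn_banach_closed_point (hconv p.1) (hclosed p.1) hmem
  set w : F := (InnerProductSpace.toDual ℝ F).symm f with hw
  have hf : ∀ z, f z = inner ℝ w z := fun z => by simp [hw]
  obtain ⟨a₀, ha₀, -⟩ := key 0 (by simp; positivity)
  have hw0 : 0 < ‖w‖ := by
    rw [norm_pos_iff]
    intro h0
    have := hfa a₀ ha₀
    simp only [hf, h0, inner_zero_left] at this hfu
    linarith
  obtain ⟨a, ha, had⟩ := key ((ε / 2 / ‖w‖) • w) (by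
    rw [norm_smul, Real.norm_of_nonneg (by positivity)]
    exact (div_mul_cancel₀ _ hw0.ne').le)
  have h3 := hfa a ha
  have h4 : inner ℝ w (p.2 + (ε / 2 / ‖w‖) • w - a) ≤ ‖w‖ * (ε / 4) :=
    (real_inner_le_norm _ _).trans (by gcongr)
  rw [inner_sub_right, inner_add_right, inner_smul_right, real_inner_self_eq_norm_sq] at h4
  rw [hf] at h3 hfu
  have h5 : ε / 2 / ‖w‖ * ‖w‖ ^ 2 = ‖w‖ * (ε / 2) := by field_simp
  nlinarith

/-- Local convergence does not see distant points, but a segment does: joining a far point of `A h`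
to one near the origin crosses the sphere of radius R + 2, where points of `A h` would have to be
within 1 of `D`. -/
lemma TendstoLocallyHausdorff.eventually_subset_closedBall {A : ℝ → Set F} {D : Set F}
    (hA : TendstoLocallyHausdorff A D) (hconv : ∀ h, Convex ℝ (A h))
    (hD : Bornology.IsBounded D) (h0 : (0 : F) ∈ D) :
    ∃ R > 0, ∀ᶠ h in 𝓝[>] (0 : ℝ), A h ⊆ closedBall 0 R := by
  obtain ⟨R, hR, hDR⟩ := hD.subset_closedBall_lt 0 0
  refine ⟨R + 2, by positivity, ?_⟩
  filter_upwards [hA (R + 2) (by positivity) 1 one_pos] with h ⟨h1, h2⟩ z hz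
  by_contra hzR
  obtain ⟨a, ha, had⟩ := mem_thickening_iff.1 (h2 ⟨h0, by simp; positivity⟩)
  rw [dist_zero_left] at had
  rw [mem_closedBall_zero_iff, not_le] at hzR
  have hcont : ContinuousOn (fun v : F => ‖v‖) (segment ℝ a z) := continuous_norm.continuousOn
  obtain ⟨v, hv, hvn⟩ := (convex_segment a z).isPreconnected.intermediate_value
    (left_mem_segment ℝ a z) (right_mem_segment ℝ a z) hcont
    (show R + 2 ∈ Icc ‖a‖ ‖z‖ from ⟨by linarith, hzR.le⟩)
  obtain ⟨w, hw, hwd⟩ := mem_thickening_iff.1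
    (h1 ⟨(hconv h).segment_subset ha hz hv, by simp [hvn]⟩)
  have h3 := mem_closedBall_zero_iff.1 (hDR hw)
  have h4 := norm_le_norm_add_norm_sub w v
  simp only at hvn
  rw [dist_comm, dist_eq_norm] at hwd
  linarith

end LocallyHausdorff

/-! ### Volume and boundedness of the indicatrix. -/

section SolidQuadric

variable {F ι : Type*} [NormedAddCommGroup F] [InnerProductSpace ℝ F] [Fintype ι]

/-- In the coordinates of `b`, the diagonal map with entries √(k i) carries the quadric to the unit
ball. -/
lemma solidQuadric_volume_of_pos [MeasurableSpace F] [BorelSpace F] [FiniteDimensional ℝ F]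
    {d : ℕ} (b : OrthonormalBasis (Fin d) ℝ F) {k : Fin d → ℝ} (hk : ∀ i, 0 < k i) :
    volume (solidQuadric b k) = ENNReal.ofReal (unitBallVolume d / √(∏ i, k i)) := by
  have hpre : solidQuadric b k =
      b.repr ⁻¹' {z : EuclideanSpace ℝ (Fin d) | ∑ i, k i * z i ^ 2 ≤ 1} := by
    ext y
    simp [solidQuadric, b.repr_apply_apply]
  have hmeas : MeasurableSet {z : EuclideanSpace ℝ (Fin d) | ∑ i, k i * z i ^ 2 ≤ 1} :=
    (isClosed_le (by fun_prop) continuous_const).measurableSet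
  rw [hpre, b.measurePreserving_repr.measure_preimage hmeas.nullMeasurableSet]
  set f : EuclideanSpace ℝ (Fin d) →ₗ[ℝ] EuclideanSpace ℝ (Fin d) :=
    Matrix.toEuclideanLin (Matrix.diagonal fun i => √(k i)) with hf
  have hdet : LinearMap.det f = √(∏ i, k i) := by
    rw [hf, Matrix.toEuclideanLin_eq_toLin_orthonormal, LinearMap.det_toLin, Matrix.det_diagonal]
    rw [Real.sqrt_eq_rpow, ← Real.finsetProd_rpow _ _ (fun i _ => (hk i).le)]
    simp [Real.sqrt_eq_rpow]
  have hdet0 : 0 < √(∏ i, k i) := Real.sqrt_pos.2 (Finset.prod_pos fun i _ => hk i)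
  have hset : {z : EuclideanSpace ℝ (Fin d) | ∑ i, k i * z i ^ 2 ≤ 1} =
      f ⁻¹' closedBall 0 1 := by
    ext z
    have hfz : ∀ i, f z i = √(k i) * z i := fun i => by
      simp [hf, Matrix.toLpLin_apply, Matrix.mulVec_diagonal]
    rw [mem_preimage, mem_closedBall_zero_iff, EuclideanSpace.norm_eq, Real.sqrt_le_one]
    simp [hfz, mul_pow, Real.sq_sqrt (hk _).le]
  rw [hset, Measure.addHaar_preimage_linearMap _ (by rw [hdet]; exact hdet0.ne'), hdet,
    abs_of_pos (inv_pos.2 hdet0), div_eq_inv_mul, ENNReal.ofReal_mul (by positivity),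
    unitBallVolume, ofReal_measureReal (isCompact_closedBall _ _).measure_lt_top.ne]

lemma unitBallVolume_pos (d : ℕ) : 0 < unitBallVolume d := by
  rw [unitBallVolume, measureReal_def]
  exact ENNReal.toReal_pos (measure_closedBall_pos _ _ one_pos).ne'
    (isCompact_closedBall _ _).measure_lt_top.ne

/-- Replacing each k i by k i + ε gives an ellipsoid inside the quadric, and its volume blows up as
ε → 0. -/
lemma solidQuadric_volume_of_prod_eq_zero [MeasurableSpace F] [BorelSpace F]
    [FiniteDimensional ℝ F] {d : ℕ} (b : OrthonormalBasis (Fin d) ℝ F) {k : Fin d → ℝ}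
    (hk : ∀ i, 0 ≤ k i) (h0 : ∏ i, k i = 0) : volume (solidQuadric b k) = ⊤ := by
  have hle : ∀ ε > 0, ENNReal.ofReal (unitBallVolume d / √(∏ i, (k i + ε))) ≤
      volume (solidQuadric b k) := by
    intro ε hε
    rw [← solidQuadric_volume_of_pos b (k := fun i => k i + ε)
      (fun i => by have := hk i; positivity)]
    refine measure_mono fun y hy => le_trans (b := ∑ i, (k i + ε) * inner ℝ (b i) y ^ 2) ?_ hy
    gcongr
    linarith
  have hlim : Tendsto (fun ε : ℝ => √(∏ i, (k i + ε))) (𝓝[>] 0) (𝓝[>] 0) := by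
    refine tendsto_nhdsWithin_iff.2 ⟨?_, ?_⟩
    · have : Continuous fun ε : ℝ => √(∏ i, (k i + ε)) := by fun_prop
      have h := (this.tendsto 0).mono_left (nhdsWithin_le_nhds (s := Ioi 0))
      simpa [h0] using h
    · filter_upwards [self_mem_nhdsWithin] with ε hε
      exact Real.sqrt_pos.2 (Finset.prod_pos fun i _ => add_pos_of_nonneg_of_pos (hk i) hε)
  have h1 : Tendsto (fun ε : ℝ => ENNReal.ofReal (unitBallVolume d / √(∏ i, (k i + ε))))
      (𝓝[>] 0) (𝓝 ⊤) :=
    ENNReal.tendsto_ofReal_nhds_top.2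
      ((tendsto_inv_nhdsGT_zero.comp hlim).const_mul_atTop (unitBallVolume_pos d))
  exact top_le_iff.1 (le_of_tendsto h1 (eventually_mem_nhdsWithin.mono hle))

lemma isBounded_solidQuadric_of_pos (b : OrthonormalBasis ι ℝ F) {k : ι → ℝ}
    (hk : ∀ i, 0 < k i) : Bornology.IsBounded (solidQuadric b k) := by
  refine (isBounded_iff_subset_closedBall 0).2 ⟨√(∑ i, (k i)⁻¹), fun y hy => ?_⟩
  have hy : ∑ i, k i * inner ℝ (b i) y ^ 2 ≤ 1 := hy
  rw [mem_closedBall_zero_iff]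
  refine Real.le_sqrt_of_sq_le ?_
  rw [← b.sum_sq_inner_right]
  refine Finset.sum_le_sum fun i _ => ?_
  rw [← one_div, le_div_iff₀' (hk i)]
  exact (Finset.single_le_sum (f := fun i => k i * inner ℝ (b i) y ^ 2)
    (fun i _ => mul_nonneg (hk i).le (sq_nonneg _)) (Finset.mem_univ i)).trans hy

end SolidQuadric

/-! ### Parabolic coordinates at the boundary point. -/

section Coordinates

variable {n : ℕ}

lemma finrank_orthogonal_span_unit {N : EuclideanSpace ℝ (Fin n)} (hN : ‖N‖ = 1) :
    Module.finrank ℝ (Submodule.span ℝ {N})ᗮ = n - 1 := by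
  have h := Submodule.finrank_add_finrank_orthogonal (Submodule.span ℝ {N})
  rw [finrank_span_singleton (by rintro rfl; simp at hN), finrank_euclideanSpace_fin] at h
  omega

lemma measurePreserving_smul_add_orthogonal {N : EuclideanSpace ℝ (Fin n)} (hN : ‖N‖ = 1) :
    MeasurePreserving (fun p : ℝ × (Submodule.span ℝ {N})ᗮ =>
      p.1 • N + (p.2 : EuclideanSpace ℝ (Fin n))) (volume.prod volume) volume := by
  have h1 := (LinearIsometryEquiv.toSpanUnitSingleton (𝕜 := ℝ) N hN).measurePreserving.prod
    (MeasurePreserving.id (volume : Measure (Submodule.span ℝ {N})ᗮ))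
  have h2 := WithLp.volume_preserving_toLp (Submodule.span ℝ {N}) (Submodule.span ℝ {N})ᗮ
  have h3 := (Submodule.span ℝ {N}).orthogonalDecomposition.symm.measurePreserving
  have hcomp : (fun p : ℝ × (Submodule.span ℝ {N})ᗮ =>
      p.1 • N + (p.2 : EuclideanSpace ℝ (Fin n))) =
      (Submodule.span ℝ {N}).orthogonalDecomposition.symm ∘ WithLp.toLp 2 ∘
        Prod.map (LinearIsometryEquiv.toSpanUnitSingleton (𝕜 := ℝ) N hN) id := by
    funext p
    simp
  rw [hcomp]
  exact h3.comp (h2.comp h1)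

lemma volume_preimage_prodMap_smul {F : Type*} [NormedAddCommGroup F] [InnerProductSpace ℝ F]
    [MeasurableSpace F] [BorelSpace F] [FiniteDimensional ℝ F] {c s : ℝ} (hc : c ≠ 0)
    (hs : s ≠ 0) {B : Set (ℝ × F)} (hB : MeasurableSet B) :
    (volume.prod volume) (Prod.map (c • ·) (s • ·) ⁻¹' B) =
      ENNReal.ofReal |(c * s ^ Module.finrank ℝ F)⁻¹| * (volume.prod volume) B := by
  rw [← Measure.map_apply (by fun_prop) hB, ← Measure.map_prod_map _ _ (by fun_prop) (by fun_prop),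
    Measure.map_addHaar_smul _ hc, Measure.map_addHaar_smul _ hs, Measure.prod_smul_left,
    Measure.prod_smul_right, smul_smul, Measure.smul_apply, smul_eq_mul,
    ← ENNReal.ofReal_mul (abs_nonneg _), ← abs_mul, mul_inv]
  simp

lemma volume_eq_mul_volume_coordinates {N : EuclideanSpace ℝ (Fin n)} (hN : ‖N‖ = 1)
    (x : EuclideanSpace ℝ (Fin n)) {h : ℝ} (hh : 0 < h) {B : Set (EuclideanSpace ℝ (Fin n))}
    (hB : MeasurableSet B) :
    volume B = ENNReal.ofReal (h * √(2 * h) ^ (n - 1)) *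
      (volume.prod volume) {p : ℝ × (Submodule.span ℝ {N})ᗮ |
        x - (h * p.1) • N + √(2 * h) • (p.2 : EuclideanSpace ℝ (Fin n)) ∈ B} := by
  have hs : 0 < √(2 * h) := by positivity
  have hpos : 0 < h * √(2 * h) ^ (n - 1) := by positivity
  have hmp := measurePreserving_smul_add_orthogonal hN
  have hB' : MeasurableSet ((fun y => x + y) ⁻¹' B) := hB.preimage (by fun_prop)
  have hset : {p : ℝ × (Submodule.span ℝ {N})ᗮ |
        x - (h * p.1) • N + √(2 * h) • (p.2 : EuclideanSpace ℝ (Fin n)) ∈ B} =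
      Prod.map ((-h) • ·) (√(2 * h) • ·) ⁻¹' ((fun p : ℝ × (Submodule.span ℝ {N})ᗮ =>
      p.1 • N + (p.2 : EuclideanSpace ℝ (Fin n))) ⁻¹' ((fun y => x + y) ⁻¹' B)) := by
    ext p
    simp [sub_eq_add_neg, add_assoc]
  rw [hset, volume_preimage_prodMap_smul (neg_ne_zero.2 hh.ne') hs.ne'
    (hmp.measurable hB'), hmp.measure_preimage hB'.nullMeasurableSet, measure_preimage_add,
    finrank_orthogonal_span_unit hN, neg_mul, inv_neg, abs_neg, abs_of_pos (inv_pos.2 hpos),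
    ← mul_assoc, ← ENNReal.ofReal_mul hpos.le, mul_inv_cancel₀ hpos.ne', ENNReal.ofReal_one,
    one_mul]

end Coordinates

/-! ### The intersection of the body with its translated dilate. -/

section SymmetricBody

variable {n : ℕ} {K : Set (EuclideanSpace ℝ (Fin n))} {x N : EuclideanSpace ℝ (Fin n)}

lemma mem_smul_vadd_smul_iff {τ : ℝ} (hτ : 0 < τ) (p y : EuclideanSpace ℝ (Fin n)) :
    y ∈ p +ᵥ τ • K ↔ τ⁻¹ • (y - p) ∈ K := by
  rw [mem_vadd_set_iff_neg_vadd_mem, mem_smul_set_iff_inv_smul_mem₀ hτ.ne', vadd_eq_add,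
    neg_add_eq_sub]

lemma smul_mem_of_abs_le_one (hK : Convex ℝ K) (hsymm : ∀ y ∈ K, -y ∈ K) (hx : x ∈ K) {t : ℝ}
    (ht : |t| ≤ 1) : t • x ∈ K := by
  rw [abs_le] at ht
  have := hK hx (hsymm x hx) (a := (1 + t) / 2) (b := (1 - t) / 2) (by linarith) (by linarith)
    (by ring)
  convert this using 1
  module

/-- Adding the support inequalities at y + (ε/2)N and at -y cancels y and leaves ε/2 ≤ 2⟨x, N⟩. -/
lemma IsOuterUnitNormal.inner_pos (hN : IsOuterUnitNormal K x N)
    (hint : (interior K).Nonempty) (hsymm : ∀ y ∈ K, -y ∈ K) :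
    0 < inner ℝ x N := by
  obtain ⟨y, hy⟩ := hint
  obtain ⟨ε, hε, hball⟩ := Metric.isOpen_iff.1 isOpen_interior y hy
  have h1 : y + (ε / 2) • N ∈ K := interior_subset (hball (by
    rw [mem_ball, dist_self_add_left, norm_smul, hN.1, Real.norm_of_nonneg (by positivity)]
    linarith))
  have h2 := hN.2 _ h1
  have h3 := hN.2 _ (hsymm _ (interior_subset hy))
  rw [inner_add_left, inner_smul_left, real_inner_self_eq_norm_sq, hN.1] at h2
  rw [inner_neg_left] at h3
  simp at h2
  linarith

/-- Each body lies in a slab orthogonal to N whose bounding heights are attained on ℝx. The extreme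
heights of the intersection are therefore those of the intersected segments of that line. -/
lemma widthInDirection_inter_of_le (hK : Convex ℝ K) (hsymm : ∀ y ∈ K, -y ∈ K) (hx : x ∈ K)
    (hN : IsOuterUnitNormal K x N) (hH : 0 < inner ℝ x N) {τ l : ℝ} (hτ : 0 < τ) (hl : 0 < l)
    (hlτ : l ≤ 1 + τ) :
    widthInDirection (K ∩ (l • x +ᵥ τ • K)) N =
      (min 1 (l + τ) - max (-1) (l - τ)) * inner ℝ x N := by
  have hlow : ∀ y ∈ K, -inner ℝ x N ≤ inner ℝ y N := fun y hy => by
    have := hN.2 _ (hsymm y hy)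
    rw [inner_neg_left] at this
    linarith
  have hline : ∀ t : ℝ, |t| ≤ 1 → |t - l| ≤ τ → t • x ∈ K ∩ (l • x +ᵥ τ • K) := by
    refine fun t ht htl => ⟨smul_mem_of_abs_le_one hK hsymm hx ht, ?_⟩
    rw [mem_smul_vadd_smul_iff hτ, ← sub_smul, smul_smul]
    refine smul_mem_of_abs_le_one hK hsymm hx ?_
    rwa [abs_mul, abs_of_pos (inv_pos.2 hτ), inv_mul_le_iff₀ hτ, mul_one]
  have hbound : ∀ y ∈ K ∩ (l • x +ᵥ τ • K), (l - τ) * inner ℝ x N ≤ inner ℝ y N ∧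
      inner ℝ y N ≤ (l + τ) * inner ℝ x N := by
    rintro y ⟨-, hy⟩
    rw [mem_smul_vadd_smul_iff hτ] at hy
    have h1 := hN.2 _ hy
    have h2 := hlow _ hy
    rw [inner_smul_left, inner_sub_left, inner_smul_left] at h1 h2
    simp only [conj_trivial] at h1 h2
    rw [inv_mul_le_iff₀ hτ] at h1
    rw [le_inv_mul_iff₀ hτ] at h2
    constructor <;> linarith
  have hmax : IsGreatest ((fun y => inner ℝ y N) '' (K ∩ (l • x +ᵥ τ • K)))
      (min 1 (l + τ) * inner ℝ x N) := by
    constructor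
    · refine ⟨min 1 (l + τ) • x, hline _ ?_ ?_, by simp [inner_smul_left]⟩ <;>
      rw [abs_le] <;> constructor <;> grind
    · rintro _ ⟨y, hy, rfl⟩
      rw [min_mul_of_nonneg _ _ hH.le, one_mul]
      exact le_min (hN.2 y hy.1) (hbound y hy).2
  have hmin : IsLeast ((fun y => inner ℝ y N) '' (K ∩ (l • x +ᵥ τ • K)))
      (max (-1) (l - τ) * inner ℝ x N) := by
    constructor
    · refine ⟨max (-1) (l - τ) • x, hline _ ?_ ?_, by simp [inner_smul_left]⟩ <;>
      rw [abs_le] <;> constructor <;> grind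
    · rintro _ ⟨y, hy, rfl⟩
      rw [max_mul_of_nonneg _ _ hH.le, neg_one_mul]
      exact max_le (hlow y hy.1) (hbound y hy).1
  rw [widthInDirection, hmax.csSup_eq, hmin.csInf_eq, sub_mul]

lemma widthInDirection_inter_of_lt (hsymm : ∀ y ∈ K, -y ∈ K)
    (hN : IsOuterUnitNormal K x N) (hH : 0 < inner ℝ x N) {τ l : ℝ} (hτ : 0 < τ)
    (hlτ : 1 + τ < l) :
    widthInDirection (K ∩ (l • x +ᵥ τ • K)) N = 0 := by
  have hempty : K ∩ (l • x +ᵥ τ • K) = ∅ := by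
    refine eq_empty_iff_forall_notMem.2 ?_
    rintro y ⟨hy, hy'⟩
    rw [mem_smul_vadd_smul_iff hτ] at hy'
    have h1 := hN.2 _ hy
    have h2 := hN.2 _ (hsymm _ hy')
    rw [inner_neg_left, inner_smul_left, inner_sub_left, inner_smul_left] at h2
    simp only [conj_trivial] at h2
    rw [neg_le, le_inv_mul_iff₀ hτ] at h2
    nlinarith
  -- The width is 0 by the default values of `sSup ∅` and `sInf ∅`.
  simp [widthInDirection, hempty]

/-- The bounds on h leave one branch of the min and max: the first two exclude that one segment
contains the other, and the third excludes an overlap at the far end with l > 0. The third also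
makes the resulting multiplier positive. -/
lemma isPointOfWidth_iff (hK : Convex ℝ K) (hsymm : ∀ y ∈ K, -y ∈ K) (hx : x ∈ K)
    (hN : IsOuterUnitNormal K x N) (hH : 0 < inner ℝ x N) {τ h : ℝ} (hτ : 0 < τ) (hh : 0 < h)
    (h2 : h < 2 * inner ℝ x N) (h2τ : h < 2 * τ * inner ℝ x N)
    (h1τ : h < (1 + τ) * inner ℝ x N) (p : EuclideanSpace ℝ (Fin n)) :
    IsPointOfWidth K τ x N h p ↔ p = (1 + τ - h / inner ℝ x N) • x := by
  set H := inner ℝ x N with hHdef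
  have hq : h / H * H = h := div_mul_cancel₀ _ hH.ne'
  have hq2 : h / H < 2 := by rwa [div_lt_iff₀ hH]
  have hq2τ : h / H < 2 * τ := by rwa [div_lt_iff₀ hH]
  have hq1τ : h / H < 1 + τ := by rwa [div_lt_iff₀ hH]
  have hq0 : 0 < h / H := by positivity
  constructor
  · rintro ⟨⟨l, hl, rfl⟩, hw⟩
    rcases lt_or_ge (1 + τ) l with hlt | hle
    · rw [widthInDirection_inter_of_lt hsymm hN hH hτ hlt] at hw
      exact absurd hw hh.ne
    · rw [widthInDirection_inter_of_le hK hsymm hx hN hH hτ hl hle, ← eq_div_iff hH.ne'] at hw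
      congr 1
      grind
  · rintro rfl
    refine ⟨⟨_, by linarith, rfl⟩, ?_⟩
    rw [widthInDirection_inter_of_le hK hsymm hx hN hH hτ (by linarith) (by linarith)]
    rw [← hHdef, min_eq_left (by linarith), max_eq_right (by linarith)]
    linear_combination hq

lemma eventually_isPointOfWidth_iff (hK : Convex ℝ K) (hsymm : ∀ y ∈ K, -y ∈ K) (hx : x ∈ K)
    (hN : IsOuterUnitNormal K x N) (hH : 0 < inner ℝ x N) {τ : ℝ} (hτ : 0 < τ) :
    ∀ᶠ h in 𝓝[>] (0 : ℝ), ∀ p, IsPointOfWidth K τ x N h p ↔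
      p = (1 + τ - h / inner ℝ x N) • x := by
  have hlt : ∀ c > (0 : ℝ), ∀ᶠ h in 𝓝[>] (0 : ℝ), h < c := fun c hc =>
    nhdsWithin_le_nhds (Iio_mem_nhds hc)
  filter_upwards [self_mem_nhdsWithin, hlt (2 * inner ℝ x N) (by positivity),
    hlt (2 * τ * inner ℝ x N) (by positivity), hlt ((1 + τ) * inner ℝ x N) (by positivity)]
    with h h0 h1 h2 h3
  exact isPointOfWidth_iff hK hsymm hx hN hH hτ h0 h1 h2 h3

lemma convex_rescaledSection (hK : Convex ℝ K) (h : ℝ) : Convex ℝ (rescaledSection K x N h) := by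
  intro y hy z hz a b ha hb hab
  have := hK hy hz ha hb hab
  obtain rfl : b = 1 - a := by linarith
  change x - h • N + √(2 * h) • ((a • y + (1 - a) • z : (Submodule.span ℝ {N})ᗮ) :
    EuclideanSpace ℝ (Fin n)) ∈ K
  convert this using 1
  push_cast
  module

lemma isClosed_rescaledSection (hK : IsClosed K) (h : ℝ) :
    IsClosed (rescaledSection K x N h) :=
  hK.preimage (f := fun y : (Submodule.span ℝ {N})ᗮ =>
    x - h • N + √(2 * h) • (y : EuclideanSpace ℝ (Fin n))) (by fun_prop)

lemma mem_iff_mem_rescaledSection {h r : ℝ} (hr : 0 < r)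
    (w : (Submodule.span ℝ {N})ᗮ) :
    x - (h * r) • N + √(2 * h) • (w : EuclideanSpace ℝ (Fin n)) ∈ K ↔
      (√r)⁻¹ • w ∈ rescaledSection K x N (h * r) := by
  have hsr : √r ≠ 0 := (Real.sqrt_pos.2 hr).ne'
  change _ ↔ x - (h * r) • N + √(2 * (h * r)) • (((√r)⁻¹ • w : (Submodule.span ℝ {N})ᗮ) :
    EuclideanSpace ℝ (Fin n)) ∈ K
  rw [← mul_assoc 2, Real.sqrt_mul' _ hr.le, Submodule.coe_smul, smul_smul, mul_assoc (√(2 * h)),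
    mul_inv_cancel₀ hsr, mul_one]

lemma sub_inner_smul_mem_orthogonal (hN : ‖N‖ = 1) (x : EuclideanSpace ℝ (Fin n)) :
    x - (inner ℝ x N) • N ∈ (Submodule.span ℝ {N})ᗮ := by
  rw [Submodule.mem_orthogonal_singleton_iff_inner_left, inner_sub_left, inner_smul_left,
    real_inner_self_eq_norm_sq, hN]
  simp

/-- The map y ↦ -(y - p)/τ takes p + τK onto K and its lowest point p - τx to x, turning height
above the bottom into depth below x. The shift is the component of x orthogonal to N, since p moves
along x rather than along N. -/
lemma mem_vadd_iff_mem_rescaledSection (hsymm : ∀ y ∈ K, -y ∈ K) (hN : ‖N‖ = 1)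
    (hH : 0 < inner ℝ x N) {τ h r : ℝ} (hτ : 0 < τ) (hr : r < 1) (hh : 0 < h)
    (w : (Submodule.span ℝ {N})ᗮ) :
    x - (h * r) • N + √(2 * h) • (w : EuclideanSpace ℝ (Fin n)) ∈
        (1 + τ - h / inner ℝ x N) • x +ᵥ τ • K ↔
      (√(τ * (1 - r)))⁻¹ • (-w - (√(2 * h) / (2 * inner ℝ x N)) •
        (⟨_, sub_inner_smul_mem_orthogonal hN x⟩ : (Submodule.span ℝ {N})ᗮ)) ∈
      rescaledSection K x N (h * (1 - r) / τ) := by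
  have hr' : 0 < 1 - r := by linarith
  have hiff : ∀ y, y ∈ K ↔ -y ∈ K := fun y => ⟨hsymm y, fun hy => by simpa using hsymm _ hy⟩
  rw [mem_smul_vadd_smul_iff hτ, hiff]
  change _ ↔ x - (h * (1 - r) / τ) • N + √(2 * (h * (1 - r) / τ)) • (((√(τ * (1 - r)))⁻¹ •
    (-w - (√(2 * h) / (2 * inner ℝ x N)) •
        (⟨_, sub_inner_smul_mem_orthogonal hN x⟩ : (Submodule.span ℝ {N})ᗮ)) :
          (Submodule.span ℝ {N})ᗮ) : EuclideanSpace ℝ (Fin n)) ∈ K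
  have hs : √(2 * (h * (1 - r) / τ)) * (√(τ * (1 - r)))⁻¹ = τ⁻¹ * √(2 * h) := by
    rw [← div_eq_mul_inv, ← Real.sqrt_div' _ (by positivity),
      show 2 * (h * (1 - r) / τ) / (τ * (1 - r)) = (2 * h) / τ ^ 2 by field_simp,
      Real.sqrt_div' _ (by positivity), Real.sqrt_sq hτ.le, div_eq_inv_mul]
  have hsq : √(2 * h) * √(2 * h) = 2 * h := Real.mul_self_sqrt (by positivity)
  rw [Submodule.coe_smul, smul_smul, hs]
  push_cast
  have hcoef : τ⁻¹ * √(2 * h) * (√(2 * h) / (2 * inner ℝ x N)) = τ⁻¹ * (h / inner ℝ x N) := by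
    field_simp
    linear_combination hsq
  rw [smul_sub (τ⁻¹ * √(2 * h)), smul_smul (τ⁻¹ * √(2 * h)), hcoef]
  refine iff_of_eq (congrArg (· ∈ K) ?_)
  match_scalars <;> field_simp <;> ring

end SymmetricBody

/-! ### The radial integral of the double paraboloid. -/

lemma integral_sqrt_pow {a : ℝ} (ha : 0 < a) (d : ℕ) :
    ∫ u in (0 : ℝ)..a, √u ^ d = 2 / (d + 2) * √a ^ d * a := by
  have hpow : ∀ u : ℝ, 0 ≤ u → √u ^ d = u ^ ((d : ℝ) / 2) := fun u hu => by
    rw [Real.sqrt_eq_rpow, ← Real.rpow_natCast, ← Real.rpow_mul hu]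
    congr 1
    ring
  have hd : (0 : ℝ) ≤ (d : ℝ) / 2 := by positivity
  rw [intervalIntegral.integral_congr (g := fun u => u ^ ((d : ℝ) / 2))
    (fun u hu => hpow u (by rw [uIcc_of_le ha.le] at hu; exact hu.1)),
    integral_rpow (Or.inl (by linarith)), Real.rpow_add_one ha.ne',
    Real.zero_rpow (by positivity), hpow a ha.le]
  field_simp
  ring

/-- The branches of the min cross at a = τ/(1+τ). The part beyond a is τ⁻¹ times the part before it,
and a(1 + τ⁻¹) = 1. -/
lemma integral_sqrt_min_pow {τ : ℝ} (hτ : 0 < τ) (d : ℕ) :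
    ∫ r in (0 : ℝ)..1, √(min r (τ * (1 - r))) ^ d = 2 / (d + 2) * √(τ / (1 + τ)) ^ d := by
  set a := τ / (1 + τ) with ha
  have ha0 : 0 < a := by positivity
  have ha1 : a * (1 + τ) = τ := div_mul_cancel₀ _ (by positivity)
  have hcont : Continuous fun r : ℝ => √(min r (τ * (1 - r))) ^ d := by fun_prop
  have hlt : a < 1 := by nlinarith
  have h1 : ∫ r in (0 : ℝ)..a, √(min r (τ * (1 - r))) ^ d = ∫ r in (0 : ℝ)..a, √r ^ d := by
    refine intervalIntegral.integral_congr fun r hr => ?_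
    rw [uIcc_of_le ha0.le] at hr
    rw [min_eq_left (by nlinarith [hr.2])]
  have h2 : ∫ r in a..1, √(min r (τ * (1 - r))) ^ d = τ⁻¹ * ∫ r in (0 : ℝ)..a, √r ^ d := by
    have hsub := intervalIntegral.integral_comp_sub_mul (a := a) (b := 1)
      (fun u : ℝ => √u ^ d) hτ.ne' τ
    rw [show τ - τ * 1 = 0 by ring, show τ - τ * a = a by linarith, smul_eq_mul] at hsub
    rw [← hsub]
    refine intervalIntegral.integral_congr fun r hr => ?_
    rw [uIcc_of_le hlt.le] at hr
    rw [min_eq_right (by nlinarith [hr.1]), mul_sub, mul_one]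
  rw [← intervalIntegral.integral_add_adjacent_intervals (hcont.intervalIntegrable 0 a)
    (hcont.intervalIntegrable a 1), h1, h2, integral_sqrt_pow ha0]
  have : a + τ⁻¹ * a = 1 := by
    rw [ha]
    field_simp
    ring
  linear_combination (2 / ((d : ℝ) + 2) * √a ^ d) * this

/-! ### Convergence of the rescaled regions to the double paraboloid. -/

section QuadricLimit

variable {F ι : Type*} [NormedAddCommGroup F] [InnerProductSpace ℝ F] [Fintype ι]

/-- The diagonal quadratic form whose unit sublevel set is `solidQuadric b k`. -/
noncomputable def diagonalQuadric (b : OrthonormalBasis ι ℝ F) (k : ι → ℝ) (y : F) : ℝ :=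
  ∑ i, k i * inner ℝ (b i) y ^ 2

variable {b : OrthonormalBasis ι ℝ F} {k : ι → ℝ}

lemma continuous_diagonalQuadric : Continuous (diagonalQuadric b k) := by
  unfold diagonalQuadric
  fun_prop

lemma diagonalQuadric_smul (c : ℝ) (y : F) :
    diagonalQuadric b k (c • y) = c ^ 2 * diagonalQuadric b k y := by
  simp only [diagonalQuadric, inner_smul_right, Finset.mul_sum]
  exact Finset.sum_congr rfl fun i _ => by ring

lemma diagonalQuadric_neg (y : F) : diagonalQuadric b k (-y) = diagonalQuadric b k y := by
  simp [diagonalQuadric]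

lemma mem_solidQuadric_iff {y : F} : y ∈ solidQuadric b k ↔ diagonalQuadric b k y ≤ 1 := Iff.rfl

lemma isClosed_solidQuadric : IsClosed (solidQuadric b k) :=
  isClosed_le continuous_diagonalQuadric continuous_const

lemma mem_interior_solidQuadric {y : F} (hy : diagonalQuadric b k y < 1) :
    y ∈ interior (solidQuadric b k) :=
  interior_maximal (fun _ hz => le_of_lt hz)
    (isOpen_lt continuous_diagonalQuadric continuous_const) hy

lemma diagonalQuadric_inv_sqrt_smul {r : ℝ} (hr : 0 < r) (y : F) :
    diagonalQuadric b k ((√r)⁻¹ • y) = diagonalQuadric b k y / r := by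
  rw [diagonalQuadric_smul, inv_pow, Real.sq_sqrt hr.le, div_eq_inv_mul]

/-- The region over `(0, 1)` whose fibre at `r` is the intersection of the sublevel sets of the
quadratic form at the levels `r` and `τ * (1 - r)`. -/
def doubleParaboloid (b : OrthonormalBasis ι ℝ F) (k : ι → ℝ) (τ : ℝ) : Set (ℝ × F) :=
  {p | p.1 ∈ Ioo (0 : ℝ) 1 ∧ diagonalQuadric b k p.2 ≤ min p.1 (τ * (1 - p.1))}

variable [MeasurableSpace F] [BorelSpace F] [FiniteDimensional ℝ F]

lemma measurableSet_doubleParaboloid (τ : ℝ) : MeasurableSet (doubleParaboloid b k τ) := by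
  refine (measurableSet_Ioo.preimage measurable_fst).inter (IsClosed.measurableSet ?_)
  exact isClosed_le (continuous_diagonalQuadric.comp continuous_snd) (by fun_prop)

lemma volume_diagonalQuadric_le {m : ℝ} (hm : 0 < m) :
    volume {y : F | diagonalQuadric b k y ≤ m} =
      ENNReal.ofReal (√m ^ Module.finrank ℝ F) * volume (solidQuadric b k) := by
  have hs : 0 < √m := Real.sqrt_pos.2 hm
  have hset : {y : F | diagonalQuadric b k y ≤ m} = ((√m)⁻¹ • ·) ⁻¹' solidQuadric b k := by
    ext y
    rw [mem_preimage, mem_solidQuadric_iff, diagonalQuadric_inv_sqrt_smul hm, div_le_one hm]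
    rfl
  rw [hset, Measure.addHaar_preimage_smul _ (inv_ne_zero hs.ne'), inv_pow, inv_inv,
    abs_of_pos (by positivity)]

lemma volume_doubleParaboloid {τ : ℝ} (hτ : 0 < τ) :
    (volume.prod volume) (doubleParaboloid b k τ) =
      ENNReal.ofReal (2 / (Module.finrank ℝ F + 2) * √(τ / (1 + τ)) ^ Module.finrank ℝ F) *
        volume (solidQuadric b k) := by
  set d := Module.finrank ℝ F
  have hcont : Continuous fun r : ℝ => √(min r (τ * (1 - r))) ^ d := by fun_prop
  rw [Measure.prod_apply (measurableSet_doubleParaboloid τ)]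
  have hslice : ∀ r : ℝ, volume (Prod.mk r ⁻¹' doubleParaboloid b k τ) =
      (Ioo (0 : ℝ) 1).indicator (fun r => ENNReal.ofReal (√(min r (τ * (1 - r))) ^ d) *
        volume (solidQuadric b k)) r := by
    intro r
    by_cases hr : r ∈ Ioo (0 : ℝ) 1
    · have hm : 0 < min r (τ * (1 - r)) := lt_min hr.1 (mul_pos hτ (by linarith [hr.2]))
      rw [indicator_of_mem hr, ← volume_diagonalQuadric_le hm]
      congr 1
      ext y
      simp [doubleParaboloid, hr.1, hr.2]
    · rw [indicator_of_notMem hr]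
      convert measure_empty (μ := (volume : Measure F))
      ext y
      simp only [doubleParaboloid, mem_preimage, mem_ofPred_eq, mem_empty_iff_false, iff_false]
      exact fun h => hr h.1
  rw [lintegral_congr hslice, lintegral_indicator measurableSet_Ioo,
    lintegral_mul_const _ (by fun_prop), ← integral_sqrt_min_pow hτ d,
    ← ofReal_integral_eq_lintegral_ofReal, intervalIntegral.integral_of_le zero_le_one,
    integral_Ioc_eq_integral_Ioo]
  · exact (hcont.integrableOn_Icc (a := 0) (b := 1)).mono_set Ioo_subset_Icc_self
  · exact ae_of_all _ fun r => by positivity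

/-- For fixed w the equality holds for at most two values of r. -/
lemma ae_diagonalQuadric_ne {τ : ℝ} (hτ : 0 < τ) :
    ∀ᵐ p ∂((volume : Measure ℝ).prod (volume : Measure F)),
      diagonalQuadric b k p.2 ≠ min p.1 (τ * (1 - p.1)) := by
  have hmeas : MeasurableSet {p : ℝ × F | diagonalQuadric b k p.2 = min p.1 (τ * (1 - p.1))} :=
    (isClosed_eq (continuous_diagonalQuadric.comp continuous_snd) (by fun_prop)).measurableSet
  rw [ae_iff]
  simp only [not_not]
  rw [Measure.prod_apply_symm hmeas, lintegral_eq_zero_of_ae_eq_zero]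
  refine ae_of_all _ fun w => ?_
  refine measure_mono_null (t := {diagonalQuadric b k w, 1 - diagonalQuadric b k w / τ}) ?_
    (Set.Finite.measure_zero (by simp) _)
  intro r (hr : diagonalQuadric b k w = min r (τ * (1 - r)))
  rcases min_choice r (τ * (1 - r)) with h | h
  · exact Or.inl (hr.trans h).symm
  · refine Or.inr ?_
    rw [mem_singleton_iff, hr.trans h]
    field_simp
    ring

variable {A : ℝ → Set F} {G : ℝ → Set (ℝ × F)} {τ : ℝ} {v : F} {c : ℝ → ℝ}

/-- Off the null set of equality, a point is strictly inside both limiting fibres or strictly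
outside one of them, and either situation persists for small h. -/
lemma ae_eventually_mem_iff_mem_doubleParaboloid
    (hA : TendstoLocallyHausdorff A (solidQuadric b k)) (hconv : ∀ h, Convex ℝ (A h))
    (hclosed : ∀ h, IsClosed (A h)) (hτ : 0 < τ) (hc : Tendsto c (𝓝[>] 0) (𝓝 0))
    (hG : ∀ h > 0, ∀ p, p ∈ G h ↔ p.1 ∈ Ioo (0 : ℝ) 1 ∧ (√p.1)⁻¹ • p.2 ∈ A (h * p.1) ∧
      (√(τ * (1 - p.1)))⁻¹ • (-p.2 - c h • v) ∈ A (h * (1 - p.1) / τ)) :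
    ∀ᵐ p ∂((volume : Measure ℝ).prod (volume : Measure F)), ∀ᶠ h in 𝓝[>] (0 : ℝ),
      p ∈ G h ↔ p ∈ doubleParaboloid b k τ := by
  filter_upwards [ae_diagonalQuadric_ne (b := b) (k := k) hτ] with p hp
  obtain ⟨r, w⟩ := p
  by_cases hr : r ∈ Ioo (0 : ℝ) 1
  swap
  · filter_upwards [self_mem_nhdsWithin] with h hh
    exact iff_of_false (fun hm => hr ((hG h hh _).1 hm).1) (fun hm => hr hm.1)
  have hr1 : 0 < 1 - r := by linarith [hr.2]
  have hτr : 0 < τ * (1 - r) := by positivity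
  have hscale : ∀ a > (0 : ℝ), Tendsto (fun h : ℝ => h * a) (𝓝[>] 0) (𝓝[>] 0) := by
    intro a ha
    refine tendsto_nhdsWithin_iff.2 ⟨?_, ?_⟩
    · have : Continuous fun h : ℝ => h * a := by fun_prop
      simpa using (this.tendsto 0).mono_left (nhdsWithin_le_nhds (s := Ioi 0))
    · filter_upwards [self_mem_nhdsWithin] with h (hh : 0 < h)
      exact mul_pos hh ha
  have ht1 : Tendsto (fun h : ℝ => (h * r, (√r)⁻¹ • w)) (𝓝[>] 0)
      (𝓝[>] (0 : ℝ) ×ˢ 𝓝 ((√r)⁻¹ • w)) := (hscale r hr.1).prodMk tendsto_const_nhds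
  have ht2 : Tendsto (fun h : ℝ => (h * (1 - r) / τ, (√(τ * (1 - r)))⁻¹ • (-w - c h • v))) (𝓝[>] 0)
      (𝓝[>] (0 : ℝ) ×ˢ 𝓝 ((√(τ * (1 - r)))⁻¹ • -w)) := by
    refine Tendsto.prodMk ?_ ?_
    · simpa only [mul_div_assoc] using hscale ((1 - r) / τ) (by positivity)
    · have := ((hc.smul_const v).const_sub (-w)).const_smul (√(τ * (1 - r)))⁻¹
      simpa using this
  have hq1 := diagonalQuadric_inv_sqrt_smul (b := b) (k := k) hr.1 w
  have hq2 := diagonalQuadric_inv_sqrt_smul (b := b) (k := k) hτr (-w)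
  rw [diagonalQuadric_neg] at hq2
  rcases lt_or_gt_of_ne hp with hlt | hgt
  · simp only [lt_min_iff] at hlt
    have e1 := ht1.eventually (hA.eventually_mem hconv hclosed
      (mem_interior_solidQuadric (by rw [hq1]; exact (div_lt_one hr.1).2 hlt.1)))
    have e2 := ht2.eventually (hA.eventually_mem hconv hclosed
      (mem_interior_solidQuadric (by rw [hq2]; exact (div_lt_one hτr).2 hlt.2)))
    filter_upwards [self_mem_nhdsWithin, e1, e2] with h hh h1 h2
    exact iff_of_true ((hG h hh _).2 ⟨hr, h1, h2⟩) ⟨hr, le_min hlt.1.le hlt.2.le⟩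
  · have hnot : (r, w) ∉ doubleParaboloid b k τ := fun hm => absurd hm.2 (not_le.2 hgt)
    simp only [min_lt_iff] at hgt
    rcases hgt with hgt | hgt
    · have e1 := ht1.eventually (hA.eventually_notMem isClosed_solidQuadric
        (by rw [mem_solidQuadric_iff, hq1, not_le]; exact (one_lt_div hr.1).2 hgt))
      filter_upwards [self_mem_nhdsWithin, e1] with h hh h1
      exact iff_of_false (fun hm => h1 ((hG h hh _).1 hm).2.1) hnot
    · have e2 := ht2.eventually (hA.eventually_notMem isClosed_solidQuadric
        (by rw [mem_solidQuadric_iff, hq2, not_le]; exact (one_lt_div hτr).2 hgt))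
      filter_upwards [self_mem_nhdsWithin, e2] with h hh h2
      exact iff_of_false (fun hm => h2 ((hG h hh _).1 hm).2.2) hnot

/-- A bounded quadric gives a common bounded box, so dominated convergence applies. If its volume is
infinite, only lower bounds are needed, and they come from truncating to balls. -/
lemma tendsto_volume_doubleParaboloid
    (hA : TendstoLocallyHausdorff A (solidQuadric b k)) (hconv : ∀ h, Convex ℝ (A h))
    (hclosed : ∀ h, IsClosed (A h)) (hτ : 0 < τ) (hc : Tendsto c (𝓝[>] 0) (𝓝 0))
    (hGm : ∀ h, MeasurableSet (G h))
    (hG : ∀ h > 0, ∀ p, p ∈ G h ↔ p.1 ∈ Ioo (0 : ℝ) 1 ∧ (√p.1)⁻¹ • p.2 ∈ A (h * p.1) ∧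
      (√(τ * (1 - p.1)))⁻¹ • (-p.2 - c h • v) ∈ A (h * (1 - p.1) / τ))
    (hD : Bornology.IsBounded (solidQuadric b k) ∨ volume (solidQuadric b k) = ⊤) :
    Tendsto (fun h => (volume.prod volume) (G h)) (𝓝[>] 0)
      (𝓝 ((volume.prod volume) (doubleParaboloid b k τ))) := by
  have hae := ae_eventually_mem_iff_mem_doubleParaboloid hA hconv hclosed hτ hc hG
  have hDm := measurableSet_doubleParaboloid (b := b) (k := k) τ
  have hBm : ∀ R : ℝ, MeasurableSet (Icc (0 : ℝ) 1 ×ˢ closedBall (0 : F) R) := fun R =>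
    measurableSet_Icc.prod measurableSet_closedBall
  have hBfin : ∀ R : ℝ, (volume.prod volume) (Icc (0 : ℝ) 1 ×ˢ closedBall (0 : F) R) ≠ ⊤ :=
    fun R => (isCompact_Icc.prod (isCompact_closedBall 0 R)).measure_lt_top.ne
  rcases hD with hbdd | htop
  · obtain ⟨R, hR, hev⟩ := hA.eventually_subset_closedBall hconv hbdd
      (by simp [mem_solidQuadric_iff, diagonalQuadric])
    refine tendsto_measure_of_ae_tendsto_indicator _ hDm hGm (hBm R) (hBfin R) ?_ hae
    -- Since r < 1, the depth `h * r` stays below δ, which makes the bound uniform in r.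
    obtain ⟨δ, hδ, hsub⟩ := mem_nhdsGT_iff_exists_Ioo_subset.1 hev
    filter_upwards [Ioo_mem_nhdsGT hδ] with h hh
    rintro ⟨r, w⟩ hp
    obtain ⟨hr, hmem, -⟩ := (hG h hh.1 _).1 hp
    simp only at hr hmem
    have h1 := hsub (show h * r ∈ Ioo 0 δ from
      ⟨mul_pos hh.1 hr.1, by nlinarith [hh.1, hh.2, hr.1, hr.2]⟩) hmem
    have hsr : 0 < √r := Real.sqrt_pos.2 hr.1
    rw [mem_closedBall_zero_iff, norm_smul, Real.norm_of_nonneg (by positivity),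
      inv_mul_le_iff₀ hsr] at h1
    refine ⟨⟨hr.1.le, hr.2.le⟩, mem_closedBall_zero_iff.2 (h1.trans ?_)⟩
    exact mul_le_of_le_one_left hR.le (Real.sqrt_le_one.2 hr.2.le)
  · have hP : (volume.prod volume) (doubleParaboloid b k τ) = ⊤ := by
      rw [volume_doubleParaboloid hτ, htop, ENNReal.mul_top]
      rw [ENNReal.ofReal_ne_zero_iff]
      positivity
    rw [hP]
    have htrunc : ∀ R : ℝ, Tendsto
        (fun h => (volume.prod volume) (G h ∩ Icc (0 : ℝ) 1 ×ˢ closedBall (0 : F) R)) (𝓝[>] 0)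
        (𝓝 ((volume.prod volume) (doubleParaboloid b k τ ∩ Icc (0 : ℝ) 1 ×ˢ closedBall 0 R))) := by
      intro R
      refine tendsto_measure_of_ae_tendsto_indicator _ (hDm.inter (hBm R))
        (fun h => (hGm h).inter (hBm R)) (hBm R) (hBfin R)
        (Eventually.of_forall fun h => inter_subset_right) ?_
      filter_upwards [hae] with p hp
      filter_upwards [hp] with h hh
      rw [mem_inter_iff, mem_inter_iff, hh]
    have hunion : ⋃ m : ℕ, doubleParaboloid b k τ ∩ Icc (0 : ℝ) 1 ×ˢ closedBall 0 (m : ℝ) =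
        doubleParaboloid b k τ := by
      rw [← inter_iUnion, inter_eq_left]
      intro p hp
      obtain ⟨m, hm⟩ := exists_nat_ge ‖p.2‖
      exact mem_iUnion.2 ⟨m, ⟨hp.1.1.le, hp.1.2.le⟩, mem_closedBall_zero_iff.2 hm⟩
    have hmono : Monotone fun m : ℕ =>
        doubleParaboloid b k τ ∩ Icc (0 : ℝ) 1 ×ˢ closedBall 0 (m : ℝ) := fun m m' hm =>
      inter_subset_inter_right _
        (prod_mono_right (closedBall_subset_closedBall (by exact_mod_cast hm)))
    have hlim := tendsto_measure_iUnion_atTop (μ := volume.prod volume) hmono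
    rw [hunion, hP] at hlim
    rw [ENNReal.tendsto_nhds_top_iff_nnreal]
    intro M
    obtain ⟨m, hm⟩ := (hlim.eventually (lt_mem_nhds (ENNReal.coe_lt_top (r := M)))).exists
    filter_upwards [(htrunc m).eventually (lt_mem_nhds hm)] with h hh
    exact hh.trans_le (measure_mono inter_subset_left)

end QuadricLimit

/-! ### From the limiting volume to the curvature. -/

section Curvature

variable {n : ℕ} {K : Set (EuclideanSpace ℝ (Fin n))} {x N : EuclideanSpace ℝ (Fin n)}

/-- The intersection of `K` with its translated dilate, in the coordinates `(r, w)` of the point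
`x - (h * r) • N + √(2 * h) • w` at depth `h * r` below `x`. -/
def rescaledIntersection (K : Set (EuclideanSpace ℝ (Fin n))) (x N : EuclideanSpace ℝ (Fin n))
    (τ h : ℝ) : Set (ℝ × (Submodule.span ℝ {N})ᗮ) :=
  {p | x - (h * p.1) • N + √(2 * h) • (p.2 : EuclideanSpace ℝ (Fin n)) ∈
    K ∩ ((1 + τ - h / inner ℝ x N) • x +ᵥ τ • K)}

lemma fst_mem_Icc_of_mem_rescaledIntersection (hsymm : ∀ y ∈ K, -y ∈ K)
    (hN : IsOuterUnitNormal K x N) (hH : 0 < inner ℝ x N) {τ h : ℝ} (hτ : 0 < τ) (hh : 0 < h)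
    {p : ℝ × (Submodule.span ℝ {N})ᗮ} (hp : p ∈ rescaledIntersection K x N τ h) :
    p.1 ∈ Icc (0 : ℝ) 1 := by
  obtain ⟨h1, h2⟩ := hp
  have hw : inner ℝ (p.2 : EuclideanSpace ℝ (Fin n)) N = 0 :=
    Submodule.mem_orthogonal_singleton_iff_inner_left.1 p.2.2
  have hinner : inner ℝ (x - (h * p.1) • N + √(2 * h) • (p.2 : EuclideanSpace ℝ (Fin n))) N =
      inner ℝ x N - h * p.1 := by
    rw [inner_add_left, inner_sub_left, inner_smul_left, inner_smul_left,
      real_inner_self_eq_norm_sq, hN.1, hw]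
    simp
  rw [mem_smul_vadd_smul_iff hτ] at h2
  have h3 := hN.2 _ h1
  have h4 := hN.2 _ (hsymm _ h2)
  rw [inner_neg_left, inner_smul_left, inner_sub_left, hinner, inner_smul_left] at h4
  rw [hinner] at h3
  simp only [conj_trivial] at h4
  rw [neg_le, le_inv_mul_iff₀ hτ] at h4
  have h5 : h / inner ℝ x N * inner ℝ x N = h := div_mul_cancel₀ _ hH.ne'
  constructor
  · by_contra hneg
    nlinarith
  · by_contra hgt
    nlinarith

lemma tendsto_volume_rescaledIntersection (hconv : Convex ℝ K) (hclosed : IsClosed K)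
    (hsymm : ∀ y ∈ K, -y ∈ K) (hN : IsOuterUnitNormal K x N) (hH : 0 < inner ℝ x N)
    {b : OrthonormalBasis (Fin (n - 1)) ℝ (Submodule.span ℝ {N})ᗮ} {k : Fin (n - 1) → ℝ}
    (hA : TendstoLocallyHausdorff (rescaledSection K x N) (solidQuadric b k))
    (hD : Bornology.IsBounded (solidQuadric b k) ∨ volume (solidQuadric b k) = ⊤)
    {τ : ℝ} (hτ : 0 < τ) :
    Tendsto (fun h => (volume.prod volume) (rescaledIntersection K x N τ h)) (𝓝[>] 0)
      (𝓝 (ENNReal.ofReal (2 / (n + 1) * √(τ / (1 + τ)) ^ (n - 1)) *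
        volume (solidQuadric b k))) := by
  -- The subtraction `n - 1` is truncated, but a unit vector rules out n = 0.
  have hn : ((n - 1 : ℕ) : ℝ) + 2 = n + 1 := by
    rcases n with _ | n
    · have := hN.1
      rw [Subsingleton.elim N 0, norm_zero] at this
      exact absurd this zero_ne_one
    · push_cast [Nat.add_sub_cancel]
      ring
  have hclosed' : ∀ h, IsClosed (rescaledIntersection K x N τ h) := by
    intro h
    have hset : rescaledIntersection K x N τ h =
        (fun p : ℝ × (Submodule.span ℝ {N})ᗮ =>
          x - (h * p.1) • N + √(2 * h) • (p.2 : EuclideanSpace ℝ (Fin n))) ⁻¹' K ∩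
        (fun p : ℝ × (Submodule.span ℝ {N})ᗮ =>
          τ⁻¹ • (x - (h * p.1) • N + √(2 * h) • (p.2 : EuclideanSpace ℝ (Fin n)) -
            (1 + τ - h / inner ℝ x N) • x)) ⁻¹' K := by
      ext p
      exact and_congr Iff.rfl (mem_smul_vadd_smul_iff hτ _ _)
    rw [hset]
    exact (hclosed.preimage (by fun_prop)).inter (hclosed.preimage (by fun_prop))
  have hIoo : MeasurableSet (Prod.fst ⁻¹' Ioo 0 1 : Set (ℝ × (Submodule.span ℝ {N})ᗮ)) :=
    measurableSet_Ioo.preimage measurable_fst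
  have hc : Tendsto (fun h : ℝ => √(2 * h) / (2 * inner ℝ x N)) (𝓝[>] 0) (𝓝 0) := by
    have : Continuous fun h : ℝ => √(2 * h) / (2 * inner ℝ x N) := by fun_prop
    simpa using (this.tendsto 0).mono_left (nhdsWithin_le_nhds (s := Ioi 0))
  have hlim := tendsto_volume_doubleParaboloid (τ := τ)
    (G := fun h => Prod.fst ⁻¹' Ioo 0 1 ∩ rescaledIntersection K x N τ h)
    (v := ⟨_, sub_inner_smul_mem_orthogonal hN.1 x⟩) hA
    (convex_rescaledSection hconv) (isClosed_rescaledSection hclosed) hτ hc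
    (fun h => hIoo.inter (hclosed' h).measurableSet) (fun h hh p => by
      refine and_congr_right fun hp => and_congr ?_ ?_
      · exact mem_iff_mem_rescaledSection hp.1 p.2
      · exact mem_vadd_iff_mem_rescaledSection hsymm hN.1 hH hτ hp.2 hh p.2) hD
  rw [volume_doubleParaboloid hτ, finrank_orthogonal_span_unit hN.1, hn] at hlim
  refine hlim.congr' ?_
  filter_upwards [self_mem_nhdsWithin] with h hh
  refine measure_congr ?_
  -- The end levels r = 0 and r = 1, where the rescaling of a fibre degenerates, form a null set.
  have hne : ∀ᵐ p ∂((volume : Measure ℝ).prod (volume : Measure (Submodule.span ℝ {N})ᗮ)),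
      p.1 ∉ ({0, 1} : Set ℝ) :=
    Measure.quasiMeasurePreserving_fst.ae ((toFinite ({0, 1} : Set ℝ)).countable.ae_notMem _)
  filter_upwards [hne] with p hp
  refine propext (and_iff_right_of_imp fun hmem => ?_)
  have := fst_mem_Icc_of_mem_rescaledIntersection hsymm hN hH hτ hh hmem
  simp only [mem_insert_iff, mem_singleton_iff, not_or] at hp
  exact ⟨lt_of_le_of_ne this.1 (Ne.symm hp.1), lt_of_le_of_ne this.2 hp.2⟩

lemma curvatureConst_pow (n : ℕ) :
    curvatureConst n ^ (n + 1) = 2 ^ (n + 1) * (unitBallVolume (n - 1) / (n + 1)) ^ 2 := by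
  have hpos : 0 ≤ unitBallVolume (n - 1) / (n + 1) := by
    have := unitBallVolume_pos (n - 1)
    positivity
  rw [curvatureConst, mul_pow, ← Real.rpow_natCast ((_ : ℝ) ^ _), ← Real.rpow_mul hpos]
  congr 1
  rw [show (2 : ℝ) / (n + 1) * ((n + 1 : ℕ) : ℝ) = (2 : ℕ) by push_cast; field_simp,
    Real.rpow_natCast]

/-- The limit of the rescaled volumes recovers the product of the principal curvatures. -/
lemma tendsto_curvature_of_isDupinIndicatrix (hconv : Convex ℝ K) (hcompact : IsCompact K)
    (hsymm : ∀ y ∈ K, -y ∈ K) (hH : 0 < inner ℝ x N)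
    {b : OrthonormalBasis (Fin (n - 1)) ℝ (Submodule.span ℝ {N})ᗮ} {k : Fin (n - 1) → ℝ}
    (hk : ∀ i, 0 ≤ k i) (hx : IsDupinIndicatrix K x N (solidQuadric b k)) {τ : ℝ} (hτ : 0 < τ) :
    Tendsto (fun h : ℝ => curvatureConst n ^ (n + 1) * h ^ (n + 1) /
      (((1 + τ) / τ) ^ (n - 1) *
        volume.real (K ∩ ((1 + τ - h / inner ℝ x N) • x +ᵥ τ • K)) ^ 2))
      (𝓝[>] 0) (𝓝 (∏ i, k i)) := by
  obtain ⟨-, hN, -, hA, -⟩ := hx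
  obtain ⟨m, rfl⟩ : ∃ m, n = m + 1 := by
    rcases n with _ | n
    · have := hN.1
      rw [Subsingleton.elim N 0, norm_zero] at this
      exact absurd this zero_ne_one
    · exact ⟨n, rfl⟩
  set M : ℝ → ENNReal := fun h => (volume.prod volume) (rescaledIntersection K x N τ h) with hM
  set ω := unitBallVolume m with hω
  have hω0 : 0 < ω := unitBallVolume_pos m
  set C : ℝ := ((1 + τ) / τ) ^ m with hC
  have hC0 : 0 < C := by positivity
  set q : ℝ := 2 / ((m + 1 : ℕ) + 1) * √(τ / (1 + τ)) ^ m with hq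
  have hq0 : 0 < q := by positivity
  -- The factor ((1+τ)/τ)^(n-1) in the formula exactly cancels the dependence of the limiting volume
  -- on τ.
  have hqC : C * q ^ 2 = (2 / ((m + 1 : ℕ) + 1)) ^ 2 := by
    have h1 : (√(τ / (1 + τ)) ^ m) ^ 2 = (τ / (1 + τ)) ^ m := by
      rw [← pow_mul, mul_comm, pow_mul, Real.sq_sqrt (by positivity)]
    have h2 : ((1 + τ) / τ) ^ m * (τ / (1 + τ)) ^ m = 1 := by
      rw [← mul_pow, div_mul_div_cancel₀ hτ.ne', div_self (by positivity), one_pow]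
    rw [hq, mul_pow, h1, hC, mul_left_comm, h2, mul_one]
  have hvol : ∀ h > 0, volume.real (K ∩ ((1 + τ - h / inner ℝ x N) • x +ᵥ τ • K)) =
      h * √(2 * h) ^ m * (M h).toReal := by
    intro h hh
    rw [measureReal_def, volume_eq_mul_volume_coordinates hN.1 x hh
      (hcompact.measurableSet.inter ((hcompact.smul τ).vadd _).measurableSet), ENNReal.toReal_mul,
      ENNReal.toReal_ofReal (by positivity)]
    rfl
  have hfun : ∀ᶠ h in 𝓝[>] (0 : ℝ), C⁻¹ * (2 / ((m + 1 : ℕ) + 1)) ^ 2 * ω ^ 2 *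
      ((M h).toReal⁻¹) ^ 2 = curvatureConst (m + 1) ^ (m + 1 + 1) * h ^ (m + 1 + 1) /
      (C * volume.real (K ∩ ((1 + τ - h / inner ℝ x N) • x +ᵥ τ • K)) ^ 2) := by
    filter_upwards [self_mem_nhdsWithin] with h (hh : 0 < h)
    have hs : (√(2 * h) ^ m) ^ 2 = 2 ^ m * h ^ m := by
      rw [← pow_mul, mul_comm m 2, pow_mul, Real.sq_sqrt (by positivity), mul_pow]
    rw [hvol h hh, curvatureConst_pow, mul_pow, mul_pow, hs, Nat.add_sub_cancel, ← hω]
    -- If the volume vanishes, both sides are 0 by division by zero.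
    rcases eq_or_ne (M h).toReal 0 with h0 | h0
    · simp [h0]
    · field_simp
      ring
  refine Tendsto.congr' hfun ?_
  have hlim : (volume (solidQuadric b k) = ⊤ ∨ Bornology.IsBounded (solidQuadric b k)) →
      Tendsto M (𝓝[>] 0) (𝓝 (ENNReal.ofReal q * volume (solidQuadric b k))) := fun hD =>
    tendsto_volume_rescaledIntersection hconv hcompact.isClosed hsymm hN hH hA hD.symm hτ
  rcases eq_or_ne (∏ i, k i) 0 with h0 | h0
  · have htop := solidQuadric_volume_of_prod_eq_zero b hk h0
    have hlim := hlim (Or.inl htop)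
    rw [htop, ENNReal.mul_top (by rwa [ENNReal.ofReal_ne_zero_iff])] at hlim
    -- Finiteness is needed because `toReal` sends ⊤ to 0, which would hide the divergence.
    have hfin : ∀ᶠ h in 𝓝[>] (0 : ℝ), M h ≠ ⊤ := by
      filter_upwards [self_mem_nhdsWithin] with h (hh : 0 < h) hMtop
      have hlt := (measure_mono (inter_subset_left (s := K)
        (t := (1 + τ - h / inner ℝ x N) • x +ᵥ τ • K))).trans_lt
        (hcompact.measure_lt_top (μ := volume))
      rw [volume_eq_mul_volume_coordinates hN.1 x hh
        (hcompact.measurableSet.inter ((hcompact.smul τ).vadd _).measurableSet)] at hlt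
      change _ * M h < ⊤ at hlt
      rw [hMtop, ENNReal.mul_top (by rw [ENNReal.ofReal_ne_zero_iff]; positivity)] at hlt
      exact lt_irrefl _ hlt
    have hreal : Tendsto (fun h => (M h).toReal) (𝓝[>] 0) atTop := by
      rw [← ENNReal.tendsto_ofReal_nhds_top]
      refine hlim.congr' ?_
      filter_upwards [hfin] with h hh
      rw [ENNReal.ofReal_toReal hh]
    have := ((tendsto_inv_atTop_zero.comp hreal).pow 2).const_mul
      (C⁻¹ * (2 / (((m + 1 : ℕ) : ℝ) + 1)) ^ 2 * ω ^ 2)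
    rw [h0]
    simpa using this
  · have hkpos : ∀ i, 0 < k i := fun i =>
      lt_of_le_of_ne (hk i) fun hi => h0 (Finset.prod_eq_zero (Finset.mem_univ i) hi.symm)
    have hprod : 0 < ∏ i, k i := Finset.prod_pos fun i _ => hkpos i
    have hlim := hlim (Or.inr (isBounded_solidQuadric_of_pos b hkpos))
    rw [solidQuadric_volume_of_pos b hkpos, ← ENNReal.ofReal_mul hq0.le] at hlim
    have hreal := (ENNReal.tendsto_toReal ENNReal.ofReal_ne_top).comp hlim
    change Tendsto _ _ (𝓝 (ENNReal.ofReal (q * (ω / √(∏ i, k i)))).toReal) at hreal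
    rw [ENNReal.toReal_ofReal (by positivity)] at hreal
    have := ((hreal.inv₀ (by positivity)).pow 2).const_mul
      (C⁻¹ * (2 / (((m + 1 : ℕ) : ℝ) + 1)) ^ 2 * ω ^ 2)
    have hval : C⁻¹ * (2 / (((m + 1 : ℕ) : ℝ) + 1)) ^ 2 * ω ^ 2 *
        ((q * (ω / √(∏ i, k i)))⁻¹) ^ 2 = ∏ i, k i := by
      rw [inv_pow, mul_pow, div_pow ω, Real.sq_sqrt hprod.le, ← hqC]
      field_simp
    rwa [hval] at this

end Curvature

theorem theorem3p1 {n : ℕ} (K : ConvexBody (EuclideanSpace ℝ (Fin n)))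
    (hint : (interior (K : Set (EuclideanSpace ℝ (Fin n)))).Nonempty)
    (hsymm : ∀ y ∈ (K : Set (EuclideanSpace ℝ (Fin n))), -y ∈ (K : Set (EuclideanSpace ℝ (Fin n))))
    (x : EuclideanSpace ℝ (Fin n)) (hx : IsNormalPoint (K : Set (EuclideanSpace ℝ (Fin n))) x) :
    (∃! κ : ℝ, IsGaussKroneckerCurvature (K : Set (EuclideanSpace ℝ (Fin n))) x κ) ∧
    ∀ (κ : ℝ) (N : EuclideanSpace ℝ (Fin n)) (τ : ℝ),
      IsGaussKroneckerCurvature (K : Set (EuclideanSpace ℝ (Fin n))) x κ →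
      IsOuterUnitNormal (K : Set (EuclideanSpace ℝ (Fin n))) x N →
      0 < τ →
      (∀ᶠ h in 𝓝[>] (0 : ℝ), ∃! p, IsPointOfWidth (K : Set (EuclideanSpace ℝ (Fin n))) τ x N h p) ∧
      ∀ xh : ℝ → EuclideanSpace ℝ (Fin n),
        (∀ᶠ h in 𝓝[>] (0 : ℝ),
          IsPointOfWidth (K : Set (EuclideanSpace ℝ (Fin n))) τ x N h (xh h)) →
        Tendsto
          (fun h : ℝ => curvatureConst n ^ (n + 1) * h ^ (n + 1) /
            (((1 + τ) / τ) ^ (n - 1) *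
              volume.real ((K : Set (EuclideanSpace ℝ (Fin n))) ∩
                (xh h +ᵥ τ • (K : Set (EuclideanSpace ℝ (Fin n))))) ^ 2))
          (𝓝[>] 0) (𝓝 κ) := by
  have hconv := K.convex
  have hcompact := K.isCompact
  have hxK : x ∈ (K : Set (EuclideanSpace ℝ (Fin n))) := by
    obtain ⟨N, D, hND⟩ := hx
    exact hcompact.isClosed.frontier_subset hND.1
  refine ⟨?_, fun κ N τ hκ hN hτ => ?_⟩
  · obtain ⟨N, D, hND⟩ := hx
    obtain ⟨b, k, hk, rfl⟩ := hND.2.2.2.2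
    have hH := hND.2.1.inner_pos hint hsymm
    refine ⟨_, ⟨N, b, k, hk, hND, rfl⟩, ?_⟩
    rintro _ ⟨N', b', k', hk', hND', rfl⟩
    obtain rfl := hND.2.2.1 N' hND'.2.1
    -- Both products are limits of the same function of h; τ = 1 is an arbitrary choice.
    exact tendsto_nhds_unique
      (tendsto_curvature_of_isDupinIndicatrix hconv hcompact hsymm hH hk' hND' one_pos)
      (tendsto_curvature_of_isDupinIndicatrix hconv hcompact hsymm hH hk hND one_pos)
  · obtain ⟨N', b, k, hk, hND, rfl⟩ := hκ
    obtain rfl := hND.2.2.1 N hN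
    have hH := hN.inner_pos hint hsymm
    have hiff := eventually_isPointOfWidth_iff hconv hsymm hxK hN hH hτ
    refine ⟨?_, fun xh hxh => ?_⟩
    · filter_upwards [hiff] with h hh
      exact ⟨_, (hh _).2 rfl, fun p hp => (hh p).1 hp⟩
    · refine (tendsto_curvature_of_isDupinIndicatrix hconv hcompact hsymm hH hk hND hτ).congr' ?_
      filter_upwards [hiff, hxh] with h hh hp
      rw [(hh _).1 hp]
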